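/- **Proposition 3.1.** Let $\mathbf S$ be the category of simplicial sets. For simplicial maps $f,g:X\to Z$ write $f\simeq g$ if there is a map $X\times\Delta^1\to Z$ restricting to $f$ on $X\times\{0\}$ and to $g$ on $X\times\{1\}$. Call a map in $\mathbf S$ a *fibration* if it is a Kan fibration, i.e. has the right lifting property with respect to all horn inclusions $\Lambda^p_k\to\Delta^p$ ($p>0$, $0\le k\le p$); call $Z$ a *Kan complex* if $Z\to *$ is a Kan fibration, in which case $\simeq$ is an equivalence relation on $\mathrm{Hom}(X,Z)$, and put $[X,Z]=\mathrm{Hom}(X,Z)/{\simeq}$. Call a map $f:X\to Y$ a *weak equivalence* if $f^\sharp:[Y,Z]\to[X,Z]$ is bijective for every Kan complex $Z$, and a *cofibration* if it has the left lifting property with respect to every map that is both a fibration and a weak equivalence. Let $i:A\to B$ be a map in $\mathbf S$. Then the following are equivalent: (i) $i$ is a cofibration; (ii) $i$ is a monomorphism in $\mathbf S$; (iii) $i$ is a degreewise injection, i.e. $i_n:A_n\to B_n$ is injective for every $n\ge 0$. In particular, every simplicial set $X$ is cofibrant, i.e. the map $\emptyset\to X$ from the initial object is a cofibration. -/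

import Mathlib

open CategoryTheory MonoidalCategory

universe u

namespace SimplicialModel

/-- Two maps `f, g : X ⟶ Y` of simplicial sets are homotopic if there is a map
`h : X ⊗ Δ[1] ⟶ Y` that restricts to `f` on `X × {0}` and to `g` on `X × {1}`
(`⊗` is the cartesian product of simplicial sets). -/
def Homotopic {X Y : SSet.{u}} (f g : X ⟶ Y) : Prop :=
  Nonempty (SSet.Homotopy f g)

/-- Homotopic maps remain homotopic after precomposition. -/
theorem Homotopic.precomp {X Y Z : SSet.{u}} (f : X ⟶ Y) {g g' : Y ⟶ Z}
    (H : Homotopic g g') : Homotopic (f ≫ g) (f ≫ g') := by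
  obtain ⟨H⟩ := H
  exact ⟨SSet.RelativeMorphism.Homotopy.precomp H (SSet.RelativeMorphism.botEquiv.symm f)
    (SSet.Subcomplex.isInitialBot.hom_ext _ _)⟩

/-- The homotopy set `[X, Z]`, the quotient of `X ⟶ Z` by homotopy. It is used only for
a Kan complex `Z`, where homotopy is already an equivalence relation. -/
def HomotopySet (X Z : SSet.{u}) : Type u :=
  Quot (Homotopic (X := X) (Y := Z))

/-- The map `[Y, Z] → [X, Z]` induced by `f : X ⟶ Y`. -/
def HomotopySet.precomp {X Y : SSet.{u}} (f : X ⟶ Y) (Z : SSet.{u}) :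
    HomotopySet Y Z → HomotopySet X Z :=
  Quot.map (fun g => f ≫ g) (fun _ _ H => Homotopic.precomp f H)

/-- The fibrations are the Kan fibrations: the maps with the right lifting property with
respect to the inclusions of the `k`-th horns `Λ[p, k] ⟶ Δ[p]`, `p > 0`, `0 ≤ k ≤ p`. -/
def fibrations : MorphismProperty SSet.{u} := fun _ _ f =>
  ∀ (p : ℕ) (k : Fin (p + 2)), HasLiftingProperty (SSet.horn.{u} (p + 1) k).ι f

/-- `Z` is a Kan complex if the map from `Z` to the terminal object is a Kan fibration. -/
def IsKanComplex (Z : SSet.{u}) : Prop :=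
  fibrations (Limits.terminal.from Z)

/-- A map `f : X ⟶ Y` is a weak equivalence if `[Y, Z] → [X, Z]` is bijective for every
Kan complex `Z`. -/
def weakEquivalences : MorphismProperty SSet.{u} := fun _ _ f =>
  ∀ Z : SSet.{u}, IsKanComplex Z → Function.Bijective (HomotopySet.precomp f Z)

/-- A map is a cofibration if it has the left lifting property with respect to every map
that is both a fibration and a weak equivalence. -/
def cofibrations : MorphismProperty SSet.{u} :=
  (fibrations ⊓ weakEquivalences).llp

/-- `X` is cofibrant if the map from the initial object to `X` is a cofibration. -/
def IsCofibrant (X : SSet.{u}) : Prop :=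
  cofibrations (Limits.initial.to X)

end SimplicialModel

/-!
# The cofibrations of simplicial sets are the monomorphisms

That a cofibration `i : A ⟶ B` is a monomorphism follows by lifting an embedding of `A` into a
contractible Kan complex along `i`; a cofree simplicial set serves as the complex
(`mono_of_cofibrations`).

Conversely, one has to show that a Kan fibration `p : X ⟶ Y` that is a weak equivalence has the right
lifting property with respect to all monomorphisms. Weak equivalences are defined by maps to Kan
complexes, and `Y` need not be one, so the main step is to extend `p` to a Kan fibration
`q : X' ⟶ Y'` over a Kan complex `Y'`, along an anodyne map `j : Y ⟶ Y'`
(`exists_isPullback_of_fibration`). Testing `p` against `X'` and `Y'` then yields a section of `p`,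
and a homotopy which, with a section of `q` extending that of `p`, can be made fibrewise
(`exists_lift_of_isPullback`). So `p` is a fibrewise deformation retraction, and lifts against
monomorphisms are found by homotopy lifting.

For the extension, Kan fibrations over `Y` are encoded as maps from `Y` to a universe
(`fibrationUniverse`), so that it suffices that the universe is a Kan complex, that is, that every
Kan fibration over a horn is the restriction of one over the simplex. Neither minimal fibrations nor
a subdivision functor is needed for this: the simplex `Q` deforms into the horn `P` by a homotopy that
preserves `P`, say with end `r`. Transport along the homotopy gives a map `T` from the fibration `E`
over `P` to its pullback along `r`, which is a fibrewise equivalence. That pullback is defined over all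
of `Q`, and replacing it by `E` over `P` by means of `T` gives the extension
(`exists_fibration_extension`).
-/

open Simplicial Opposite CartesianMonoidalCategory

namespace SimplicialModel

/-! ### Gluing and lifting of homotopies -/

/-- The Kan fibrations are those of Mathlib, so its theory of anodyne extensions applies. -/
lemma fibrations_iff {X Y : SSet.{u}} (p : X ⟶ Y) :
    fibrations p ↔ SSet.modelCategoryQuillen.J.rlp p := by
  constructor
  · intro hp A B i hi
    simp only [SSet.modelCategoryQuillen.J, MorphismProperty.iSup_iff] at hi
    obtain ⟨n, ⟨k⟩⟩ := hi
    exact hp n k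
  · intro hp n k
    exact hp _ (SSet.modelCategoryQuillen.horn_ι_mem_J _ _)

lemma fibrations_eq_rlp : fibrations.{u} = SSet.modelCategoryQuillen.J.rlp := by
  ext X Y p
  exact fibrations_iff p

lemma fibrations.hasLiftingProperty {X Y A B : SSet.{u}} {p : X ⟶ Y} (hp : fibrations p)
    {i : A ⟶ B} (hi : SSet.anodyneExtensions i) : HasLiftingProperty i p :=
  hi _ ((fibrations_iff p).1 hp)

lemma fibrations.exists_lift {X Y A B : SSet.{u}} {p : X ⟶ Y} (hp : fibrations p)
    {i : A ⟶ B} (hi : SSet.anodyneExtensions i) {f : A ⟶ X} {g : B ⟶ Y}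
    (w : f ≫ p = i ≫ g) : ∃ l : B ⟶ X, i ≫ l = f ∧ l ≫ p = g := by
  have := hp.hasLiftingProperty hi
  have sq : CommSq f i p g := ⟨w⟩
  exact ⟨sq.lift, sq.fac_left, sq.fac_right⟩

/-- The inclusion of `X` as the end `X × {ε}` of the cylinder `X × Δ¹`; treating both ends
uniformly in `ε` avoids a case distinction in every lifting argument below. -/
noncomputable def incl (ε : Fin 2) (X : SSet.{u}) : X ⟶ X ⊗ Δ[1] :=
  lift (𝟙 X) (SSet.const (SSet.stdSimplex.obj₀Equiv.{u}.symm ε))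

@[simp]
lemma incl_fst (X : SSet.{u}) (ε : Fin 2) : incl ε X ≫ fst X Δ[1] = 𝟙 X := rfl

@[simp]
lemma incl_fst_assoc {X Y : SSet.{u}} (ε : Fin 2) (f : X ⟶ Y) :
    incl ε X ≫ fst X Δ[1] ≫ f = f := rfl

@[simp]
lemma incl_whiskerRight_assoc {X Y Z : SSet.{u}} (f : X ⟶ Y) (ε : Fin 2) (g : Y ⊗ Δ[1] ⟶ Z) :
    incl ε X ≫ f ▷ Δ[1] ≫ g = f ≫ incl ε Y ≫ g := rfl

instance (X : SSet.{u}) (ε : Fin 2) : Mono (incl ε X) := mono_of_mono_fac (incl_fst X ε)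

lemma mem_horn_one_iff (ε : Fin 2) {n : SimplexCategoryᵒᵖ} (t : (Δ[1] : SSet.{u}).obj n) :
    t ∈ (Λ[1, ε] : (Δ[1] : SSet.{u}).Subcomplex).obj n ↔ t = SSet.stdSimplex.const 1 ε n := by
  induction n using Opposite.rec with | _ n
  induction n using SimplexCategory.rec with | _ n
  rw [SSet.mem_horn_iff_notMem_range]
  constructor
  · rintro ⟨j, hj, h⟩
    ext k : 1
    change t k = ε
    have : t k ≠ j := fun h' => h ⟨k, h'⟩
    generalize t k = a at this
    fin_cases ε <;> fin_cases j <;> fin_cases a <;> simp_all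
  · rintro rfl
    refine ⟨1 - ε, by fin_cases ε <;> simp, ?_⟩
    rintro ⟨k, hk⟩
    change ε = 1 - ε at hk
    fin_cases ε <;> simp at hk

lemma const_zero_ne_const_one (n : SimplexCategoryᵒᵖ) :
    SSet.stdSimplex.const.{u} 1 0 n ≠ SSet.stdSimplex.const 1 1 n := by
  induction n using Opposite.rec with | _ n
  induction n using SimplexCategory.rec with | _ n
  intro h
  have := congrArg (fun t : (Δ[1] : SSet.{u}) _⦋n⦌ => t 0) h
  change (0 : Fin 2) = 1 at this
  simp at this

lemma injective_of_mono {X Y : SSet.{u}} (f : X ⟶ Y) [Mono f] (n : SimplexCategoryᵒᵖ) :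
    Function.Injective (f.app n) :=
  (mono_iff_injective (f.app n)).1 inferInstance

lemma mono_of_injective {X Y : SSet.{u}} (f : X ⟶ Y)
    (h : ∀ n, Function.Injective (f.app n)) : Mono f := by
  have : ∀ n, Mono (f.app n) := fun n => (mono_iff_injective _).2 (h n)
  exact NatTrans.mono_of_mono_app f

/-- A map into the target of a monomorphism whose values are hit factors through it. -/
lemma exists_factor {X E C : SSet.{u}} (J : E ⟶ C) [Mono J] (f : X ⟶ C)
    (h : ∀ n (x : X.obj n), ∃ e, J.app n e = f.app n x) : ∃ g : X ⟶ E, g ≫ J = f := by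
  refine ⟨SSet.Subcomplex.lift f (B := SSet.Subcomplex.range J) ?_ ≫
    inv (SSet.Subcomplex.toRange J), ?_⟩
  · rintro n _ ⟨x, rfl⟩
    exact h n x
  · have : inv (SSet.Subcomplex.toRange J) ≫ J = (SSet.Subcomplex.range J).ι := by
      rw [IsIso.inv_comp_eq]
      rfl
    rw [Category.assoc, this]
    rfl

/-- Maps that agree on the intersection of two subcomplexes glue to a map on their union. The
subcomplexes are presented as the images of monomorphisms `j₁` and `j₂`. -/
lemma exists_glue {X E X₁ X₂ : SSet.{u}} (j₁ : X₁ ⟶ X) (j₂ : X₂ ⟶ X) [Mono j₁] [Mono j₂]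
    (f₁ : X₁ ⟶ E) (f₂ : X₂ ⟶ E)
    (h : ∀ n (x₁ : X₁.obj n) (x₂ : X₂.obj n), j₁.app n x₁ = j₂.app n x₂ →
      f₁.app n x₁ = f₂.app n x₂)
    (L : X.Subcomplex) (hL : SSet.Subcomplex.range j₁ ⊔ SSet.Subcomplex.range j₂ = L) :
    ∃ F : (L : SSet) ⟶ E, ∀ n (x : L.obj n),
      (∀ x₁, j₁.app n x₁ = x.1 → F.app n x = f₁.app n x₁) ∧
      (∀ x₂, j₂.app n x₂ = x.1 → F.app n x = f₂.app n x₂) := by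
  subst hL
  -- The union of the graphs of `f₁` and `f₂` is the graph of the map to be constructed.
  let R : (X ⊗ E).Subcomplex := SSet.Subcomplex.range (lift j₁ f₁) ⊔
    SSet.Subcomplex.range (lift j₂ f₂)
  have hR : ∀ n (x : X.obj n) (e : E.obj n), ((x, e) : (X ⊗ E).obj n) ∈ R.obj n ↔
      (∃ x₁, j₁.app n x₁ = x ∧ f₁.app n x₁ = e) ∨ (∃ x₂, j₂.app n x₂ = x ∧ f₂.app n x₂ = e) := by
    intro n x e
    refine or_congr ⟨?_, ?_⟩ ⟨?_, ?_⟩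
    · rintro ⟨y, hy⟩
      exact ⟨y, congrArg Prod.fst hy, congrArg Prod.snd hy⟩
    · rintro ⟨y, rfl, rfl⟩
      exact ⟨y, rfl⟩
    · rintro ⟨y, hy⟩
      exact ⟨y, congrArg Prod.fst hy, congrArg Prod.snd hy⟩
    · rintro ⟨y, rfl, rfl⟩
      exact ⟨y, rfl⟩
  have hinj : Mono (R.ι ≫ fst X E) := by
    apply mono_of_injective
    rintro n ⟨⟨x, e⟩, hx⟩ ⟨⟨x', e'⟩, hx'⟩ hxx
    obtain rfl : x = x' := hxx
    have : e = e' := by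
      replace hx := (hR _ _ _).1 hx
      replace hx' := (hR _ _ _).1 hx'
      rcases hx with ⟨y, hy, rfl⟩ | ⟨y, hy, rfl⟩ <;> rcases hx' with ⟨z, hz, rfl⟩ | ⟨z, hz, rfl⟩
      · rw [injective_of_mono j₁ n (hy.trans hz.symm)]
      · exact h n y z (hy.trans hz.symm)
      · exact (h n z y (hz.trans hy.symm)).symm
      · rw [injective_of_mono j₂ n (hy.trans hz.symm)]
    subst this
    rfl
  obtain ⟨g, hg⟩ := exists_factor (R.ι ≫ fst X E)
    (SSet.Subcomplex.range j₁ ⊔ SSet.Subcomplex.range j₂).ι (by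
      rintro n ⟨x, ⟨y, rfl⟩ | ⟨y, rfl⟩⟩
      · exact ⟨⟨(j₁.app n y, f₁.app n y), (hR _ _ _).2 (Or.inl ⟨y, rfl, rfl⟩)⟩, rfl⟩
      · exact ⟨⟨(j₂.app n y, f₂.app n y), (hR _ _ _).2 (Or.inr ⟨y, rfl, rfl⟩)⟩, rfl⟩)
  have key : ∀ n x (e : R.obj n), e.1.1 = x.1 → (g ≫ R.ι ≫ snd X E).app n x = e.1.2 := by
    intro n x e he
    have h₁ : (g ≫ R.ι ≫ fst X E).app n x = x.1 :=
      ConcreteCategory.congr_hom (NatTrans.congr_app hg n) x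
    have : g.app n x = e := injective_of_mono (R.ι ≫ fst X E) n (h₁.trans he.symm)
    rw [← this]
    rfl
  refine ⟨g ≫ R.ι ≫ snd X E, fun n x => ⟨fun y hy => ?_, fun y hy => ?_⟩⟩
  · exact key n x ⟨(j₁.app n y, f₁.app n y), (hR _ _ _).2 (Or.inl ⟨y, rfl, rfl⟩)⟩ hy
  · exact key n x ⟨(j₂.app n y, f₂.app n y), (hR _ _ _).2 (Or.inr ⟨y, rfl, rfl⟩)⟩ hy

/-- A map given by compatible pieces on `A × Δ¹ ∪ B × {ε}` lifts to `B × Δ¹`, since the inclusion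
is anodyne. -/
lemma fibrations.exists_lift_of_glue {E Y B X₁ X₂ : SSet.{u}} {p : E ⟶ Y} (hp : fibrations p)
    (A : B.Subcomplex) (ε : Fin 2) (j₁ : X₁ ⟶ B ⊗ Δ[1]) (j₂ : X₂ ⟶ B ⊗ Δ[1])
    [Mono j₁] [Mono j₂]
    (hL : SSet.Subcomplex.range j₁ ⊔ SSet.Subcomplex.range j₂ = A.unionProd Λ[1, ε])
    (f₁ : X₁ ⟶ E) (f₂ : X₂ ⟶ E) (h : B ⊗ Δ[1] ⟶ Y)
    (compat : ∀ n (x₁ : X₁.obj n) (x₂ : X₂.obj n), j₁.app n x₁ = j₂.app n x₂ →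
      f₁.app n x₁ = f₂.app n x₂)
    (h₁ : f₁ ≫ p = j₁ ≫ h) (h₂ : f₂ ≫ p = j₂ ≫ h) :
    ∃ G : B ⊗ Δ[1] ⟶ E, j₁ ≫ G = f₁ ∧ j₂ ≫ G = f₂ ∧ G ≫ p = h := by
  obtain ⟨F, hF⟩ := exists_glue j₁ j₂ f₁ f₂ compat _ hL
  obtain ⟨G, hG, hGp⟩ := hp.exists_lift (i := (A.unionProd Λ[1, ε]).ι) (f := F) (g := h)
    (SSet.anodyneExtensions_unionProd_ι _ _ (SSet.anodyneExtensions.horn_ι _)) (by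
      ext n ⟨x, hx⟩
      have hx' := hx
      rw [← hL] at hx'
      rcases hx' with ⟨y, hy⟩ | ⟨y, hy⟩
      · have := (hF n ⟨x, hx⟩).1 y hy
        refine (congrArg (p.app n) this).trans ?_
        refine (ConcreteCategory.congr_hom (NatTrans.congr_app h₁ n) y).trans ?_
        exact congrArg (h.app n) hy
      · have := (hF n ⟨x, hx⟩).2 y hy
        refine (congrArg (p.app n) this).trans ?_
        refine (ConcreteCategory.congr_hom (NatTrans.congr_app h₂ n) y).trans ?_
        exact congrArg (h.app n) hy)
  refine ⟨G, ?_, ?_, hGp⟩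
  · ext n y
    have hy : j₁.app n y ∈ (A.unionProd Λ[1, ε]).obj n := by
      rw [← hL]; exact Or.inl ⟨y, rfl⟩
    exact (ConcreteCategory.congr_hom (NatTrans.congr_app hG n) ⟨_, hy⟩).trans
      ((hF n ⟨_, hy⟩).1 y rfl)
  · ext n y
    have hy : j₂.app n y ∈ (A.unionProd Λ[1, ε]).obj n := by
      rw [← hL]; exact Or.inr ⟨y, rfl⟩
    exact (ConcreteCategory.congr_hom (NatTrans.congr_app hG n) ⟨_, hy⟩).trans
      ((hF n ⟨_, hy⟩).2 y rfl)

lemma range_whiskerRight_obj {A B : SSet.{u}} (i : A ⟶ B) (K : SSet.{u})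
    {n : SimplexCategoryᵒᵖ} (x : (B ⊗ K).obj n) :
    x ∈ (SSet.Subcomplex.range (i ▷ K)).obj n ↔ x.1 ∈ (SSet.Subcomplex.range i).obj n := by
  obtain ⟨b, t⟩ := x
  constructor
  · rintro ⟨y, hy⟩
    exact ⟨y.1, congrArg Prod.fst hy⟩
  · rintro ⟨y, hy⟩
    exact ⟨(y, t), Prod.ext hy rfl⟩

lemma range_incl_obj {B : SSet.{u}} (ε : Fin 2) {n : SimplexCategoryᵒᵖ}
    (x : (B ⊗ Δ[1]).obj n) :
    x ∈ (SSet.Subcomplex.range (incl ε B)).obj n ↔ x.2 = SSet.stdSimplex.const 1 ε n := by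
  obtain ⟨b, t⟩ := x
  constructor
  · rintro ⟨y, hy⟩
    exact (congrArg Prod.snd hy).symm
  · intro h
    exact ⟨b, Prod.ext rfl h.symm⟩

instance {A B : SSet.{u}} (i : A ⟶ B) [Mono i] (K : SSet.{u}) : Mono (i ▷ K) := by
  apply mono_of_injective
  rintro n ⟨x, t⟩ ⟨x', t'⟩ h
  exact Prod.ext (injective_of_mono i n (congrArg Prod.fst h :))
    (show t = t' from congrArg Prod.snd (show (i.app n x, t) = (i.app n x', t') from h))

lemma mem_sup {X : SSet.{u}} (A B : X.Subcomplex) {n : SimplexCategoryᵒᵖ} (x : X.obj n) :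
    x ∈ (A ⊔ B).obj n ↔ x ∈ A.obj n ∨ x ∈ B.obj n := Iff.rfl

lemma range_ι {X : SSet.{u}} (A : X.Subcomplex) : SSet.Subcomplex.range A.ι = A := by simp

lemma mem_unionProd_horn_iff {B : SSet.{u}} (A : B.Subcomplex) (ε : Fin 2)
    {n : SimplexCategoryᵒᵖ} (x : (B ⊗ Δ[1]).obj n) :
    x ∈ (A.unionProd Λ[1, ε]).obj n ↔ x.2 = SSet.stdSimplex.const 1 ε n ∨ x.1 ∈ A.obj n :=
  (SSet.Subcomplex.mem_unionProd_iff A Λ[1, ε] x).trans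
    (or_congr (mem_horn_one_iff ε x.2) Iff.rfl)

/-- Homotopy lifting, starting at either end and relative to a monomorphism `i`. -/
lemma fibrations.exists_homotopy_lift {E Y A B : SSet.{u}} {p : E ⟶ Y} (hp : fibrations p)
    (i : A ⟶ B) [Mono i] (ε : Fin 2) (f : B ⟶ E) (g : A ⊗ Δ[1] ⟶ E) (h : B ⊗ Δ[1] ⟶ Y)
    (hfg : incl ε A ≫ g = i ≫ f) (hf : f ≫ p = incl ε B ≫ h) (hg : g ≫ p = i ▷ Δ[1] ≫ h) :
    ∃ G : B ⊗ Δ[1] ⟶ E, incl ε B ≫ G = f ∧ i ▷ Δ[1] ≫ G = g ∧ G ≫ p = h := by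
  refine hp.exists_lift_of_glue (SSet.Subcomplex.range i) ε (incl ε B) (i ▷ Δ[1]) ?_ f g h ?_ hf hg
  · ext n x
    exact (or_congr (range_incl_obj ε x) (range_whiskerRight_obj i Δ[1] x)).trans
      (mem_unionProd_horn_iff _ ε x).symm
  · rintro n b ⟨a, t⟩ hx
    obtain rfl : b = i.app n a := congrArg Prod.fst hx
    obtain rfl : SSet.stdSimplex.const 1 ε n = t := congrArg Prod.snd hx
    exact (ConcreteCategory.congr_hom (NatTrans.congr_app hfg n) a).symm

/-- Two lifts `γ₀`, `γ₁` of the same homotopy that agree at the end `ε`, and on `A × Δ¹`, are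
homotopic at the end `δ`, over the base and relative to `A`. The homotopy is a face of a filler
of `S × Δ¹ × Δ¹`, prescribed to be `γ₀` and `γ₁` on two opposite faces and constant on the face
where they agree. -/
lemma fibrations.exists_homotopy_of_lifts {E Y A S : SSet.{u}} {p : E ⟶ Y} (hp : fibrations p)
    (i : A ⟶ S) [Mono i] (ε δ : Fin 2) (γ₀ γ₁ : S ⊗ Δ[1] ⟶ E)
    (hε : incl ε S ≫ γ₀ = incl ε S ≫ γ₁) (hγ : γ₀ ≫ p = γ₁ ≫ p)
    (hi : i ▷ Δ[1] ≫ γ₀ = i ▷ Δ[1] ≫ γ₁) :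
    ∃ H : S ⊗ Δ[1] ⟶ E, incl 0 S ≫ H = incl δ S ≫ γ₀ ∧ incl 1 S ≫ H = incl δ S ≫ γ₁ ∧
      H ≫ p = fst _ _ ≫ incl δ S ≫ γ₀ ≫ p ∧
      i ▷ Δ[1] ≫ H = fst _ _ ≫ incl δ A ≫ i ▷ Δ[1] ≫ γ₀ := by
  -- Subcomplexes are introduced by their membership predicates; their definitions as unions of
  -- ranges are expensive to unfold.
  obtain ⟨A', hA'⟩ : ∃ A' : (S ⊗ Δ[1]).Subcomplex, ∀ n (x : (S ⊗ Δ[1] : SSet).obj n),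
      x ∈ A'.obj n ↔ (x.2 = SSet.stdSimplex.const 1 0 n ∨ x.2 = SSet.stdSimplex.const 1 1 n) ∨
        x.1 ∈ (SSet.Subcomplex.range i).obj n :=
    ⟨SSet.Subcomplex.range (incl 0 S) ⊔ SSet.Subcomplex.range (incl 1 S) ⊔
      SSet.Subcomplex.range (i ▷ Δ[1]), fun n x => (mem_sup _ _ x).trans (or_congr
        ((mem_sup _ _ x).trans (or_congr (range_incl_obj 0 x) (range_incl_obj 1 x)))
        (range_whiskerRight_obj i Δ[1] x))⟩
  obtain ⟨L₁, hL₁⟩ : ∃ L₁ : ((S ⊗ Δ[1]) ⊗ Δ[1]).Subcomplex,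
      ∀ n (x : ((S ⊗ Δ[1]) ⊗ Δ[1] : SSet).obj n),
      x ∈ L₁.obj n ↔ x.1.2 = SSet.stdSimplex.const 1 1 n :=
    ⟨SSet.Subcomplex.range (incl 1 S ▷ Δ[1]), fun n x =>
      (range_whiskerRight_obj _ _ x).trans (range_incl_obj 1 x.1)⟩
  obtain ⟨L₂, hL₂⟩ : ∃ L₂ : ((S ⊗ Δ[1]) ⊗ Δ[1]).Subcomplex,
      ∀ n (x : ((S ⊗ Δ[1]) ⊗ Δ[1] : SSet).obj n),
      x ∈ L₂.obj n ↔ (x.1.2 = SSet.stdSimplex.const 1 0 n ∨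
        x.1.1 ∈ (SSet.Subcomplex.range i).obj n) ∨ x.2 = SSet.stdSimplex.const 1 ε n :=
    ⟨SSet.Subcomplex.range (incl 0 S ▷ Δ[1]) ⊔ SSet.Subcomplex.range ((i ▷ Δ[1]) ▷ Δ[1]) ⊔
      SSet.Subcomplex.range (incl ε (S ⊗ Δ[1])), fun n x => (mem_sup _ _ x).trans (or_congr
        ((mem_sup _ _ x).trans (or_congr
          ((range_whiskerRight_obj _ _ x).trans (range_incl_obj 0 x.1))
          ((range_whiskerRight_obj _ _ x).trans (range_whiskerRight_obj i Δ[1] x.1))))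
        (range_incl_obj ε x))⟩
  let pr : (S ⊗ Δ[1]) ⊗ Δ[1] ⟶ S ⊗ Δ[1] := fst S Δ[1] ▷ Δ[1]
  obtain ⟨G, hG₁, hG₂, hGp⟩ := hp.exists_lift_of_glue A' ε L₁.ι L₂.ι (by
      have key : ∀ a b c d : Prop, (b ∨ ((a ∨ c) ∨ d)) ↔ (d ∨ ((a ∨ b) ∨ c)) := by tauto
      rw [range_ι, range_ι]
      ext n x
      refine (mem_sup _ _ x).trans (Iff.trans ?_ (mem_unionProd_horn_iff A' ε x).symm)
      exact (or_congr (hL₁ n x) (hL₂ n x)).trans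
        ((key _ _ _ _).trans (or_congr Iff.rfl (hA' n x.1).symm)))
    (L₁.ι ≫ pr ≫ γ₁) (L₂.ι ≫ pr ≫ γ₀) (pr ≫ γ₀ ≫ p) (by
      rintro n ⟨x, hx₁⟩ ⟨x', hx₂⟩ hx
      obtain rfl : x = x' := hx
      change γ₁.app n (x.1.1, x.2) = γ₀.app n (x.1.1, x.2)
      obtain ⟨⟨s, u⟩, t⟩ := x
      rcases (hL₂ _ _).1 hx₂ with (hx₂ | hx₂) | hx₂
      · exact absurd (hx₂.symm.trans ((hL₁ _ _).1 hx₁)) (const_zero_ne_const_one n)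
      · obtain ⟨a, rfl⟩ := hx₂
        exact (ConcreteCategory.congr_hom (NatTrans.congr_app hi n)
          ((a, t) : (A ⊗ Δ[1] : SSet).obj n)).symm
      · obtain rfl : t = _ := hx₂
        exact (ConcreteCategory.congr_hom (NatTrans.congr_app hε n) s).symm)
    (by simp [hγ]) (by simp)
  refine ⟨incl δ (S ⊗ Δ[1]) ≫ G, ?_, ?_, ?_, ?_⟩
  · ext n s
    have := ConcreteCategory.congr_hom (NatTrans.congr_app hG₂ n)
      ⟨((s, SSet.stdSimplex.const 1 0 n), SSet.stdSimplex.const 1 δ n),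
        (hL₂ _ _).2 (Or.inl (Or.inl rfl))⟩
    exact this
  · ext n s
    have := ConcreteCategory.congr_hom (NatTrans.congr_app hG₁ n)
      ⟨((s, SSet.stdSimplex.const 1 1 n), SSet.stdSimplex.const 1 δ n),
        (hL₁ _ _).2 rfl⟩
    exact this
  · rw [Category.assoc, hGp]
    rfl
  · ext n ⟨a, u⟩
    have := ConcreteCategory.congr_hom (NatTrans.congr_app hG₂ n)
      ⟨((i.app n a, u), SSet.stdSimplex.const 1 δ n),
        (hL₂ _ _).2 (Or.inl (Or.inr ⟨a, rfl⟩))⟩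
    exact this


/-! ### Homotopy of maps into Kan complexes -/

lemma homotopic_iff {X Y : SSet.{u}} (f g : X ⟶ Y) :
    Homotopic f g ↔ ∃ h : X ⊗ Δ[1] ⟶ Y, incl 0 X ≫ h = f ∧ incl 1 X ≫ h = g := by
  constructor
  · rintro ⟨H⟩
    exact ⟨H.h, SSet.Homotopy.h₀ H, SSet.Homotopy.h₁ H⟩
  · rintro ⟨h, h₀, h₁⟩
    exact ⟨{ h := h, h₀ := h₀, h₁ := h₁, rel := by ext n ⟨⟨x, hx⟩, t⟩; exact hx.elim }⟩

lemma bot_whiskerRight_hom_ext {X K E : SSet.{u}}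
    (f g : ((⊥ : X.Subcomplex) : SSet) ⊗ K ⟶ E) : f = g := by
  ext n ⟨⟨x, hx⟩, t⟩
  exact hx.elim

lemma Homotopic.refl {X Y : SSet.{u}} (f : X ⟶ Y) : Homotopic f f :=
  (homotopic_iff f f).2 ⟨fst _ _ ≫ f, rfl, rfl⟩

lemma Homotopic.postcomp {X Y Z : SSet.{u}} {f g : X ⟶ Y} (H : Homotopic f g) (k : Y ⟶ Z) :
    Homotopic (f ≫ k) (g ≫ k) := by
  rw [homotopic_iff] at H ⊢
  obtain ⟨h, rfl, rfl⟩ := H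
  exact ⟨h ≫ k, rfl, rfl⟩

/-- Homotopy into a Kan complex is a Euclidean relation. -/
lemma IsKanComplex.homotopic_of_homotopic {X Z : SSet.{u}} (hZ : IsKanComplex Z)
    {f g k : X ⟶ Z} (h₁ : Homotopic f g) (h₂ : Homotopic f k) : Homotopic g k := by
  rw [homotopic_iff] at h₁ h₂ ⊢
  obtain ⟨a, ha, rfl⟩ := h₁
  obtain ⟨b, hb, rfl⟩ := h₂
  obtain ⟨H, H₀, H₁, -⟩ := fibrations.exists_homotopy_of_lifts hZ (⊥ : X.Subcomplex).ι 0 1 a b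
    (ha.trans hb.symm) (Limits.terminal.hom_ext _ _) (bot_whiskerRight_hom_ext _ _)
  exact ⟨H, H₀, H₁⟩

lemma IsKanComplex.equivalence_homotopic {X Z : SSet.{u}} (hZ : IsKanComplex Z) :
    Equivalence (Homotopic (X := X) (Y := Z)) where
  refl := Homotopic.refl
  symm h := hZ.homotopic_of_homotopic h (Homotopic.refl _)
  trans h h' := hZ.homotopic_of_homotopic (hZ.homotopic_of_homotopic h (Homotopic.refl _)) h'

lemma IsKanComplex.mk_eq_mk_iff {X Z : SSet.{u}} (hZ : IsKanComplex Z) (f g : X ⟶ Z) :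
    (Quot.mk _ f : HomotopySet X Z) = Quot.mk _ g ↔ Homotopic f g := by
  rw [Quot.eq, hZ.equivalence_homotopic.eqvGen_iff]

/-! ### Acyclic fibrations that extend to a Kan complex -/

/-- A Kan fibration with a section that is fibrewise homotopic to the identity has the right
lifting property with respect to monomorphisms. -/
lemma fibrations.exists_lift_of_deformation {X Y : SSet.{u}} {p : X ⟶ Y} (hp : fibrations p)
    (s : Y ⟶ X) (hs : s ≫ p = 𝟙 Y) (H : X ⊗ Δ[1] ⟶ X) (H₀ : incl 0 X ≫ H = p ≫ s)
    (H₁ : incl 1 X ≫ H = 𝟙 X) (Hp : H ≫ p = fst _ _ ≫ p)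
    {A B : SSet.{u}} (i : A ⟶ B) [Mono i] (f : A ⟶ X) (g : B ⟶ Y) (w : f ≫ p = i ≫ g) :
    ∃ l : B ⟶ X, i ≫ l = f ∧ l ≫ p = g := by
  obtain ⟨G, -, hGi, hGp⟩ := hp.exists_homotopy_lift i 0 (g ≫ s) (f ▷ Δ[1] ≫ H) (fst _ _ ≫ g)
    (by rw [incl_whiskerRight_assoc, H₀, reassoc_of% w])
    (by rw [incl_fst_assoc, Category.assoc, hs, Category.comp_id])
    (by rw [Category.assoc, Hp, whiskerRight_fst_assoc, whiskerRight_fst_assoc, w])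
  refine ⟨incl 1 B ≫ G, ?_, by rw [Category.assoc, hGp, incl_fst_assoc]⟩
  rw [← incl_whiskerRight_assoc, hGi, incl_whiskerRight_assoc, H₁, Category.comp_id]

lemma fibrations.comp {X Y Z : SSet.{u}} {p : X ⟶ Y} {q : Y ⟶ Z} (hp : fibrations p)
    (hq : fibrations q) : fibrations (p ≫ q) := by
  rw [fibrations_iff] at *
  exact MorphismProperty.comp_mem _ _ _ hp hq

lemma isKanComplex_of_fibration {X Y : SSet.{u}} {p : X ⟶ Y} (hp : fibrations p)
    (hY : IsKanComplex Y) : IsKanComplex X := by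
  have := hp.comp hY
  rwa [Limits.terminal.comp_from] at this

/-- A Kan fibration `p` that is a weak equivalence and extends, along an anodyne map `j`, to a
Kan fibration `q` over a Kan complex has the right lifting property with respect to monomorphisms:
it has a section that is fibrewise homotopic to the identity. -/
lemma exists_lift_of_isPullback {X Y X' Y' : SSet.{u}} {k : X ⟶ X'} {p : X ⟶ Y} {q : X' ⟶ Y'}
    {j : Y ⟶ Y'} (sq : IsPullback k p q j) (hp : fibrations p) (hw : weakEquivalences p)
    (hq : fibrations q) (hj : SSet.anodyneExtensions j) (hY' : IsKanComplex Y')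
    {A B : SSet.{u}} (i : A ⟶ B) [Mono i] (f : A ⟶ X) (g : B ⟶ Y) (w : f ≫ p = i ≫ g) :
    ∃ l : B ⟶ X, i ≫ l = f ∧ l ≫ p = g := by
  have hX' := isKanComplex_of_fibration hq hY'
  -- The weak equivalence `p` is tested against the Kan complexes `X'` and `Y'` only.
  obtain ⟨s, hs⟩ : ∃ s : Y ⟶ X', Homotopic (p ≫ s) k := by
    obtain ⟨⟨s⟩, hs⟩ := (hw X' hX').2 (Quot.mk _ k)
    exact ⟨s, (hX'.mk_eq_mk_iff _ _).1 hs⟩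
  have hsq : Homotopic (s ≫ q) j := by
    rw [← hY'.mk_eq_mk_iff]
    apply (hw Y' hY').1
    refine (hY'.mk_eq_mk_iff _ _).2 ?_
    have := hs.postcomp q
    rwa [sq.w, Category.assoc] at this
  -- Replace `s` by a homotopic map `s₁` strictly over `Y'`, so that `s₁` is a section of `p`.
  obtain ⟨c, hc₀, hc₁⟩ := (homotopic_iff _ _).1 hsq
  obtain ⟨G, hG₀, -, hGq⟩ := hq.exists_homotopy_lift (⊥ : Y.Subcomplex).ι 0 s
    (fst _ _ ≫ (⊥ : Y.Subcomplex).ι ≫ s) c rfl hc₀.symm (bot_whiskerRight_hom_ext _ _)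
  have hG₁ : (incl 1 Y ≫ G) ≫ q = j := by rw [Category.assoc, hGq, hc₁]
  have hpG : Homotopic (p ≫ incl 1 Y ≫ G) k :=
    hX'.homotopic_of_homotopic (Homotopic.precomp p ((homotopic_iff _ _).2 ⟨G, hG₀, rfl⟩)) hs
  generalize incl 1 Y ≫ G = s₁ at hG₁ hpG
  obtain ⟨h, h₀, h₁⟩ := (homotopic_iff _ _).1 hpG
  obtain ⟨s', hs', hs'q⟩ := hq.exists_lift hj (f := s₁) (g := 𝟙 Y') (by simp [hG₁])
  -- The homotopy `h` from `p ≫ s₁` to `k` need not be fibrewise, but `h ≫ q ≫ s'` lifts the same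
  -- homotopy and starts at the same map, so the other ends, `p ≫ s₁` again and `k`, are
  -- homotopic over `Y'`.
  obtain ⟨H, H₀, H₁, Hq, -⟩ := hq.exists_homotopy_of_lifts (⊥ : X.Subcomplex).ι 0 1
    (h ≫ q ≫ s') h (by rw [reassoc_of% h₀, reassoc_of% hG₁, hs', h₀]) (by simp [hs'q])
    (bot_whiskerRight_hom_ext _ _)
  rw [reassoc_of% h₁, sq.w_assoc, hs'] at H₀
  rw [h₁] at H₁
  simp only [Category.assoc, hs'q, Category.comp_id, reassoc_of% h₁, sq.w] at Hq
  let σ : Y ⟶ X := sq.lift s₁ (𝟙 Y) (by simp [hG₁])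
  have hσk : σ ≫ k = s₁ := sq.lift_fst _ _ _
  have hσp : σ ≫ p = 𝟙 Y := sq.lift_snd _ _ _
  let H' : X ⊗ Δ[1] ⟶ X := sq.lift H (fst _ _ ≫ p) (by simp [Hq])
  have hH'k : H' ≫ k = H := sq.lift_fst _ _ _
  have hH'p : H' ≫ p = fst _ _ ≫ p := sq.lift_snd _ _ _
  refine hp.exists_lift_of_deformation σ hσp H' ?_ ?_ hH'p i f g w
  · apply sq.hom_ext
    · simp [hH'k, hσk, H₀]
    · simp [hH'p, hσp]
  · apply sq.hom_ext
    · simp [hH'k, H₁]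
    · simp [hH'p]

/-! ### Cofree simplicial sets -/

section Cofree

/-- The simplicial set cofreely generated by a copy of the set `T` in each degree: a map
`X ⟶ cofree T` is a family of functions `X _⦋k⦌ → T`, with no compatibility. -/
def cofree (T : Type u) : SSet.{u} where
  obj n := (Σ k : ℕ, ⦋k⦌ ⟶ n.unop) → T
  map φ := ↾fun x a => x ⟨a.1, a.2 ≫ φ.unop⟩

variable {T : Type u}

/-- The map to a cofree simplicial set that corresponds to a family of functions. -/
def toCofree {X : SSet.{u}} (μ : ∀ k : ℕ, X _⦋k⦌ → T) : X ⟶ cofree T where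
  app n := ↾fun x a => μ a.1 (X.map a.2.op x)
  naturality m n φ := by
    ext x
    funext a
    change μ a.1 (X.map a.2.op (X.map φ x)) = μ a.1 (X.map (a.2 ≫ φ.unop).op x)
    rw [← Functor.map_comp_apply]
    rfl

/-- The tautological function on the `k`-simplices of `cofree T`; composing with it recovers the
family of functions that defines a map to `cofree T`. -/
def cofreeEval {k : ℕ} (x : (cofree T) _⦋k⦌) : T := x ⟨k, 𝟙 _⟩

lemma cofreeEval_toCofree {X : SSet.{u}} (μ : ∀ k : ℕ, X _⦋k⦌ → T) {k : ℕ} (x : X _⦋k⦌) :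
    cofreeEval ((toCofree μ).app _ x) = μ k x := by
  change μ k (X.map (𝟙 _) x) = _
  rw [Functor.map_id_apply]

lemma cofreeEval_comp_toCofree {X Y : SSet.{u}} (f : Y ⟶ X) (μ : ∀ k : ℕ, X _⦋k⦌ → T) {k : ℕ}
    (y : Y _⦋k⦌) : cofreeEval ((f ≫ toCofree μ).app _ y) = μ k (f.app _ y) :=
  cofreeEval_toCofree μ (f.app _ y)

lemma cofree_hom_ext {X : SSet.{u}} {f g : X ⟶ cofree T}
    (h : ∀ (k : ℕ) (x : X _⦋k⦌), cofreeEval (f.app _ x) = cofreeEval (g.app _ x)) : f = g := by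
  ext n x
  funext ⟨k, φ⟩
  have key : ∀ f : X ⟶ cofree T, f.app n x ⟨k, φ⟩ = cofreeEval (f.app _ (X.map φ.op x)) := by
    intro f
    rw [NatTrans.naturality_apply]
    change _ = f.app n x ⟨k, 𝟙 _ ≫ φ⟩
    rw [Category.id_comp]
  exact (key f).trans ((h k _).trans (key g).symm)

lemma mono_toCofree {X : SSet.{u}} (μ : ∀ k : ℕ, X _⦋k⦌ → T)
    (hμ : ∀ k, Function.Injective (μ k)) : Mono (toCofree μ) := by
  apply mono_of_injective
  intro n
  induction n using Opposite.rec with | _ n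
  induction n using SimplexCategory.rec with | _ n
  intro x y hxy
  apply hμ n
  rw [← cofreeEval_toCofree μ x, ← cofreeEval_toCofree μ y, hxy]

lemma cofree_extend [Nonempty T] {A B : SSet.{u}} (i : A ⟶ B) [Mono i] (f : A ⟶ cofree T) :
    ∃ g : B ⟶ cofree T, i ≫ g = f := by
  classical
  refine ⟨toCofree fun k b => if h : ∃ a, i.app _ a = b then cofreeEval (f.app _ h.choose)
    else Classical.arbitrary T, cofree_hom_ext fun k x => ?_⟩
  refine (cofreeEval_comp_toCofree _ _ x).trans ?_
  have h : ∃ a, i.app _ a = i.app _ x := ⟨x, rfl⟩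
  rw [dif_pos h, injective_of_mono i _ h.choose_spec]

lemma homotopic_cofree {X : SSet.{u}} (f g : X ⟶ cofree T) : Homotopic f g := by
  classical
  rw [homotopic_iff]
  refine ⟨toCofree fun k x => if x.2 = SSet.stdSimplex.const 1 0 _ then cofreeEval (f.app _ x.1)
    else cofreeEval (g.app _ x.1), cofree_hom_ext fun k x => ?_, cofree_hom_ext fun k x => ?_⟩
  · exact (cofreeEval_comp_toCofree _ _ x).trans (if_pos rfl)
  · exact (cofreeEval_comp_toCofree _ _ x).trans
      (if_neg (const_zero_ne_const_one _).symm)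

lemma isKanComplex_cofree [Nonempty T] : IsKanComplex (cofree T) := by
  intro p k
  constructor
  intro f g sq
  obtain ⟨l, hl⟩ := cofree_extend (SSet.horn (p + 1) k).ι f
  exact ⟨⟨⟨l, hl, Limits.terminal.hom_ext _ _⟩⟩⟩

lemma weakEquivalences_cofree [Nonempty T] :
    weakEquivalences (Limits.terminal.from (cofree T)) := by
  intro Z hZ
  obtain ⟨e⟩ : Nonempty (⊤_ SSet.{u} ⟶ cofree T) :=
    ⟨toCofree fun _ _ => Classical.arbitrary T⟩
  have he : e ≫ Limits.terminal.from (cofree T) = 𝟙 _ := Limits.terminal.hom_ext _ _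
  constructor
  · rintro ⟨f⟩ ⟨g⟩ h
    have h' : Homotopic (Limits.terminal.from (cofree T) ≫ f)
      (Limits.terminal.from (cofree T) ≫ g) := (hZ.mk_eq_mk_iff _ _).1 h
    have := Homotopic.precomp e h'
    rw [reassoc_of% he, reassoc_of% he] at this
    exact Quot.sound this
  · rintro ⟨g⟩
    refine ⟨Quot.mk _ (e ≫ g), Quot.sound ?_⟩
    have := (homotopic_cofree (Limits.terminal.from (cofree T) ≫ e) (𝟙 _)).postcomp g
    rwa [Category.id_comp, Category.assoc] at this

end Cofree

/-- The map from `cofree T` to the terminal object is an acyclic fibration, so every map from `A` to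
`cofree T` extends along a cofibration out of `A`; one of these maps is a monomorphism. The
`Option` makes sure that the cofree simplicial set is not empty. -/
lemma mono_of_cofibrations {A B : SSet.{u}} (i : A ⟶ B) (hi : cofibrations i) : Mono i := by
  let a : A ⟶ cofree (Option (Σ k : ℕ, A _⦋k⦌)) := toCofree fun k x => some ⟨k, x⟩
  have : Mono a := mono_toCofree _ fun k x y h => by simpa using h
  have := hi _ ⟨isKanComplex_cofree (T := Option (Σ k : ℕ, A _⦋k⦌)), weakEquivalences_cofree⟩
  have sq : CommSq a i (Limits.terminal.from _) (Limits.terminal.from B) :=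
    ⟨Limits.terminal.hom_ext _ _⟩
  exact mono_of_mono_fac sq.fac_left


/-! ### Extending a fibration along a deformable inclusion -/

/-- The lifting problem behind `exists_fibration_extension`. Let `T` be the end at `δ` of the
transport `s` in the fibration `E` along a homotopy `cP` that is the identity at `ε`. Given `w` over
`b` on `A`, and on `A ∩ S` an `e` over `bS` with `T e = w`, one can extend `w` to `B` and `e` to `S`
such that still `T e = w`: first extend `w` arbitrarily, obtain `e` by transporting `w` back along
`cP`, and then correct `w`, as `T e` and `w` are only homotopic on `S`. -/
lemma fibrations.exists_transport_filler {E P B : SSet.{u}} {p : E ⟶ P} (hp : fibrations p)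
    {cP : P ⊗ Δ[1] ⟶ P} {ε δ : Fin 2} (hcε : incl ε P ≫ cP = 𝟙 P)
    {s : E ⊗ Δ[1] ⟶ E} (hsp : s ≫ p = p ▷ Δ[1] ≫ cP) (hsε : incl ε E ≫ s = 𝟙 E)
    {A S : B.Subcomplex} (hA : SSet.anodyneExtensions A.ι) {b : B ⟶ P}
    {bS : (S : SSet) ⟶ P} (hbS : S.ι ≫ b = bS ≫ incl δ P ≫ cP)
    {wA : (A : SSet) ⟶ E} (hwA : wA ≫ p = A.ι ≫ b)
    {eA : ((A ⊓ S : B.Subcomplex) : SSet) ⟶ E}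
    (heA : eA ≫ p = SSet.Subcomplex.homOfLE inf_le_right ≫ bS)
    (heA' : eA ≫ incl δ E ≫ s = SSet.Subcomplex.homOfLE inf_le_left ≫ wA) :
    ∃ (w : B ⟶ E) (e : (S : SSet) ⟶ E), A.ι ≫ w = wA ∧ w ≫ p = b ∧ e ≫ p = bS ∧
      SSet.Subcomplex.homOfLE inf_le_right ≫ e = eA ∧ e ≫ incl δ E ≫ s = S.ι ≫ w := by
  obtain ⟨w₀, hw₀, hw₀p⟩ := hp.exists_lift hA hwA
  let i : ((A ⊓ S : B.Subcomplex) : SSet) ⟶ S := SSet.Subcomplex.homOfLE inf_le_right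
  let i' : ((A ⊓ S : B.Subcomplex) : SSet) ⟶ A := SSet.Subcomplex.homOfLE inf_le_left
  have hi : Mono i := inferInstance
  have hii' : i' ≫ A.ι = i ≫ S.ι := rfl
  change eA ≫ p = i ≫ bS at heA
  change eA ≫ incl δ E ≫ s = i' ≫ wA at heA'
  change ∃ (w : B ⟶ E) (e : (S : SSet) ⟶ E), A.ι ≫ w = wA ∧ w ≫ p = b ∧ e ≫ p = bS ∧
      i ≫ e = eA ∧ e ≫ incl δ E ≫ s = S.ι ≫ w
  have hsurj : ∀ n (x : (S : SSet).obj n), x.1 ∈ A.obj n → ∃ z, i.app n z = x :=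
    fun n x hx => ⟨⟨x.1, hx, x.2⟩, rfl⟩
  -- Only these equations about `i` and `i'` are needed; unfolding them slows down rewriting.
  clear_value i i'
  obtain ⟨γ, hγδ, hγi, hγp⟩ := hp.exists_homotopy_lift i δ (S.ι ≫ w₀) (eA ▷ Δ[1] ≫ s)
    (bS ▷ Δ[1] ≫ cP)
    (by rw [incl_whiskerRight_assoc, heA', ← hw₀, reassoc_of% hii'])
    (by rw [Category.assoc, hw₀p, hbS, incl_whiskerRight_assoc])
    (by rw [Category.assoc, hsp, ← comp_whiskerRight_assoc, heA, comp_whiskerRight_assoc])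
  obtain ⟨e, he⟩ : ∃ e, incl ε (S : SSet) ≫ γ = e := ⟨_, rfl⟩
  have hep : e ≫ p = bS := by
    rw [← he, Category.assoc, hγp, incl_whiskerRight_assoc, hcε, Category.comp_id]
  have hie : i ≫ e = eA := by
    rw [← he, ← incl_whiskerRight_assoc, hγi, incl_whiskerRight_assoc, hsε, Category.comp_id]
  obtain ⟨H, H₀, H₁, Hp, Hi⟩ := hp.exists_homotopy_of_lifts i ε δ γ (e ▷ Δ[1] ≫ s)
    (by rw [he, incl_whiskerRight_assoc, hsε, Category.comp_id])
    (by rw [hγp, Category.assoc, hsp, ← comp_whiskerRight_assoc, hep])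
    (by rw [hγi, ← comp_whiskerRight_assoc, hie])
  rw [hγδ] at H₀
  rw [incl_whiskerRight_assoc] at H₁
  rw [hγp, incl_whiskerRight_assoc, ← hbS] at Hp
  rw [hγi, incl_whiskerRight_assoc, heA', ← hw₀, reassoc_of% hii'] at Hi
  obtain ⟨G, hG₁, hG₂, hGp⟩ := hp.exists_lift_of_glue (A ⊔ S) 0 (A.unionProd Λ[1, 0]).ι
    (S.ι ▷ Δ[1]) (by
      ext n x
      rw [range_ι]
      refine (mem_sup _ _ x).trans (Iff.trans ?_ (mem_unionProd_horn_iff (A ⊔ S) 0 x).symm)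
      refine (or_congr (mem_unionProd_horn_iff A 0 x)
        ((range_whiskerRight_obj S.ι Δ[1] x).trans (by rw [range_ι]))).trans ?_
      exact or_assoc.trans (or_congr Iff.rfl (mem_sup A S x.1).symm))
    ((A.unionProd Λ[1, 0]).ι ≫ fst _ _ ≫ w₀) H (fst _ _ ≫ b) (by
      rintro n ⟨⟨x, t⟩, hx⟩ ⟨⟨y, hy⟩, t'⟩ hxy
      obtain rfl : x = y := congrArg Prod.fst hxy
      obtain rfl : t = t' := congrArg Prod.snd hxy
      change w₀.app n x = _
      rcases (mem_unionProd_horn_iff A 0 _).1 hx with rfl | hxA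
      · exact (ConcreteCategory.congr_hom (NatTrans.congr_app H₀ n) ⟨x, hy⟩).symm
      · obtain ⟨z, hz⟩ := hsurj n ⟨x, hy⟩ hxA
        have := ConcreteCategory.congr_hom (NatTrans.congr_app Hi n)
          ((z, t) : (((A ⊓ S : B.Subcomplex) : SSet) ⊗ Δ[1] : SSet).obj n)
        change H.app n (i.app n z, t) = w₀.app n (i.app n z).1 at this
        rw [hz] at this
        exact this.symm)
    (by rw [Category.assoc, Category.assoc, hw₀p]) (by rw [Hp, whiskerRight_fst_assoc])
  refine ⟨incl 1 B ≫ G, e, ?_, ?_, hep, hie, ?_⟩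
  · rw [← hw₀]
    ext n a
    exact ConcreteCategory.congr_hom (NatTrans.congr_app hG₁ n)
      ⟨(a.1, SSet.stdSimplex.const 1 1 n), (mem_unionProd_horn_iff A 0 _).2 (Or.inr a.2)⟩
  · rw [Category.assoc, hGp, incl_fst_assoc]
  · rw [← H₁, ← hG₂, incl_whiskerRight_assoc]

lemma congr_app_apply {X Y : SSet.{u}} {f g : X ⟶ Y} (h : f = g) {n : SimplexCategoryᵒᵖ}
    (x : X.obj n) : f.app n x = g.app n x := by rw [h]

/-- Given `p : E ⟶ P` with `P` a subcomplex of `Q`, a map `T` over the self-map of `P` induced by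
`r`, and a monomorphism `J : E ⟶ C`, this is the simplicial set over `Q` of triples `(q, w, c)`, where
`w` lies over `r q` and where, over the part of the simplex `q` that lies in `P`, the pair
`(w, c)` is `(T e, J e)` for a (necessarily unique) section `e` of `E`. Over `P` itself it is a
copy of `E`. -/
def extension {Q E C : SSet.{u}} {P : Q.Subcomplex} (p : E ⟶ P) (T : E ⟶ E) (r : Q ⟶ P)
    (J : E ⟶ C) : (Q ⊗ (E ⊗ C)).Subcomplex where
  obj n := {x | p.app n x.2.1 = r.app n x.1 ∧ ∀ (k : SimplexCategoryᵒᵖ) (φ : n ⟶ k),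
    Q.map φ x.1 ∈ P.obj k → ∃ e : E.obj k, (p.app k e).1 = Q.map φ x.1 ∧
      T.app k e = E.map φ x.2.1 ∧ J.app k e = C.map φ x.2.2}
  map := by
    rintro n m ψ ⟨q, w, c⟩ ⟨h₁, h₂⟩
    refine ⟨?_, fun k φ hφ => ?_⟩
    · change p.app m (E.map ψ w) = r.app m (Q.map ψ q)
      rw [NatTrans.naturality_apply, NatTrans.naturality_apply]
      exact congrArg _ h₁
    · change Q.map φ (Q.map ψ q) ∈ P.obj k at hφ
      change ∃ e : E.obj k, (p.app k e).1 = Q.map φ (Q.map ψ q) ∧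
        T.app k e = E.map φ (E.map ψ w) ∧ J.app k e = C.map φ (C.map ψ c)
      rw [← Functor.map_comp_apply] at hφ
      simp only [← Functor.map_comp_apply]
      exact h₂ k (ψ ≫ φ) hφ

/-- If a homotopy `c` deforms `Q` into its subcomplex `P` within `P` on `P`, then every Kan fibration
`p` over `P` is the restriction of a Kan fibration over `Q`. -/
lemma exists_fibration_extension {Q E C : SSet.{u}} (P : Q.Subcomplex) {c : Q ⊗ Δ[1] ⟶ Q}
    {ε δ : Fin 2} (hcε : incl ε Q ≫ c = 𝟙 Q)
    (hcP : ∀ n (x : (Q ⊗ Δ[1]).obj n), x.1 ∈ P.obj n → c.app n x ∈ P.obj n)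
    (hcδ : ∀ n (q : Q.obj n), c.app n (q, SSet.stdSimplex.const 1 δ n) ∈ P.obj n)
    {p : E ⟶ P} (hp : fibrations p) (J : E ⟶ C) [Mono J]
    (hC : ∀ {A B : SSet.{u}} (i : A ⟶ B) [Mono i] (f : A ⟶ C), ∃ g, i ≫ g = f) :
    ∃ (D : (Q ⊗ (E ⊗ C)).Subcomplex) (k : E ⟶ D), fibrations (D.ι ≫ fst _ _) ∧
      k ≫ D.ι ≫ fst _ _ = p ≫ P.ι ∧ Mono k ∧
      ∀ n (x : D.obj n), x.1.1 ∈ P.obj n → ∃ e, k.app n e = x := by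
  let cP : (P : SSet) ⊗ Δ[1] ⟶ P := SSet.Subcomplex.lift (P.ι ▷ Δ[1] ≫ c) (by
    rintro n _ ⟨x, rfl⟩
    exact hcP n (x.1.1, x.2) x.1.2)
  have hcPι : cP ≫ P.ι = P.ι ▷ Δ[1] ≫ c := rfl
  let r : Q ⟶ P := SSet.Subcomplex.lift (incl δ Q ≫ c) (by
    rintro n _ ⟨q, rfl⟩
    exact hcδ n q)
  have hr : P.ι ≫ r = incl δ P ≫ cP := rfl
  clear_value cP r
  have hcPε : incl ε P ≫ cP = 𝟙 _ := by
    rw [← cancel_mono P.ι, Category.assoc, hcPι, incl_whiskerRight_assoc, hcε]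
    simp
  obtain ⟨s, hsε, -, hsp⟩ := hp.exists_homotopy_lift (⊥ : E.Subcomplex).ι ε (𝟙 E)
    (fst _ _ ≫ (⊥ : E.Subcomplex).ι) (p ▷ Δ[1] ≫ cP) (by simp)
    (by rw [incl_whiskerRight_assoc, hcPε]; simp) (bot_whiskerRight_hom_ext _ _)
  let T := incl δ E ≫ s
  have hTp : T ≫ p = p ≫ P.ι ≫ r := by
    simp only [T, Category.assoc, hsp, hr, incl_whiskerRight_assoc]
  let D := extension p T r J
  let k : E ⟶ D := SSet.Subcomplex.lift (lift (p ≫ P.ι) (lift T J)) (by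
    rintro n _ ⟨e, rfl⟩
    refine ⟨congr_app_apply hTp e, fun m φ h => ⟨E.map φ e, ?_, ?_, ?_⟩⟩
    · exact NatTrans.naturality_apply (p ≫ P.ι) φ e
    · exact NatTrans.naturality_apply T φ e
    · exact NatTrans.naturality_apply J φ e)
  refine ⟨D, k, ?_, rfl, ?_, ?_⟩
  · intro m l
    constructor
    intro f b sq
    let A := SSet.horn.{u} (m + 1) l
    let S : (Δ[m + 1] : SSet.{u}).Subcomplex := P.preimage b
    let bS : (S : SSet) ⟶ P := SSet.Subcomplex.lift (S.ι ≫ b) (by rintro n _ ⟨x, rfl⟩; exact x.2)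
    have hbS : bS ≫ P.ι = S.ι ≫ b := rfl
    let i : ((A ⊓ S : (Δ[m + 1] : SSet.{u}).Subcomplex) : SSet) ⟶ S :=
      SSet.Subcomplex.homOfLE inf_le_right
    let i' : ((A ⊓ S : (Δ[m + 1] : SSet.{u}).Subcomplex) : SSet) ⟶ A :=
      SSet.Subcomplex.homOfLE inf_le_left
    have hii' : i' ≫ A.ι = i ≫ S.ι := rfl
    let wA : (A : SSet) ⟶ E := f ≫ D.ι ≫ snd _ _ ≫ fst _ _
    let cA : (A : SSet) ⟶ C := f ≫ D.ι ≫ snd _ _ ≫ snd _ _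
    have hfst : ∀ n (x : A.obj n), (f.app n x).1.1 = b.app n x.1 := fun n x =>
      congr_app_apply sq.w x
    have hwA : wA ≫ p = A.ι ≫ b ≫ r := by
      ext n x
      exact ((f.app n x).2.1).trans (congrArg (r.app n) (hfst n x))
    have hex : ∀ n (x : (A ⊓ S : (Δ[m + 1] : SSet.{u}).Subcomplex).obj n), ∃ e : E.obj n,
        (p.app n e).1 = b.app n x.1 ∧ T.app n e = wA.app n (i'.app n x) ∧
        J.app n e = cA.app n (i'.app n x) := by
      intro n x
      have h₁ : Q.map (𝟙 n) (f.app n (i'.app n x)).1.1 = b.app n x.1 := by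
        rw [Functor.map_id_apply]; exact hfst n _
      obtain ⟨e, he₁, he₂, he₃⟩ := (f.app n (i'.app n x)).2.2 n (𝟙 n) (by
        rw [h₁]; exact x.2.2)
      rw [Functor.map_id_apply] at he₂ he₃
      exact ⟨e, he₁.trans h₁, he₂, he₃⟩
    obtain ⟨eA, heA⟩ := exists_factor J (i' ≫ cA) (fun n x => by
      obtain ⟨e, -, -, he⟩ := hex n x
      exact ⟨e, he⟩)
    have heA' : ∀ n (x : (A ⊓ S : (Δ[m + 1] : SSet.{u}).Subcomplex).obj n),
        (p.app n (eA.app n x)).1 = b.app n x.1 ∧ T.app n (eA.app n x) = wA.app n (i'.app n x) := by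
      intro n x
      obtain ⟨e, h₁, h₂, h₃⟩ := hex n x
      obtain rfl : e = eA.app n x :=
        injective_of_mono J n (h₃.trans (congr_app_apply heA x).symm)
      exact ⟨h₁, h₂⟩
    obtain ⟨w, e, hw, hwp, hep, hie, heT⟩ := hp.exists_transport_filler hcPε hsp hsε (A := A)
      (S := S) (SSet.anodyneExtensions.horn_ι l) (b := b ≫ r) (bS := bS) (δ := δ)
      (by rw [← hr, reassoc_of% hbS]) hwA (eA := eA)
      (by
        rw [← cancel_mono P.ι]
        ext n x
        exact (heA' n x).1)
      (by
        ext n x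
        exact (heA' n x).2)
    obtain ⟨F, hF⟩ := exists_glue A.ι S.ι cA (e ≫ J) (by
      rintro n ⟨x, hx⟩ ⟨y, hy⟩ hxy
      obtain rfl : x = y := hxy
      have h₁ := congr_app_apply heA ⟨x, hx, hy⟩
      have h₂ := congrArg (J.app n) (congr_app_apply hie ⟨x, hx, hy⟩)
      exact h₁.symm.trans h₂.symm) (A ⊔ S) (by rw [range_ι, range_ι])
    obtain ⟨cB, hcB⟩ := hC (A ⊔ S).ι F
    have hcBA : ∀ n (x : A.obj n), cB.app n x.1 = cA.app n x := fun n x =>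
      (congr_app_apply hcB ⟨x.1, Or.inl x.2⟩).trans ((hF n ⟨x.1, Or.inl x.2⟩).1 x rfl)
    have hcBS : ∀ n (x : S.obj n), cB.app n x.1 = J.app n (e.app n x) := fun n x =>
      (congr_app_apply hcB ⟨x.1, Or.inr x.2⟩).trans ((hF n ⟨x.1, Or.inr x.2⟩).2 x rfl)
    refine ⟨⟨SSet.Subcomplex.lift (lift b (lift w cB)) ?_, ?_, ?_⟩⟩
    · rintro n _ ⟨x, rfl⟩
      refine ⟨congr_app_apply hwp x, fun k φ hk => ?_⟩
      have hk' : (Δ[m + 1] : SSet.{u}).map φ x ∈ S.obj k := by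
        change b.app k _ ∈ P.obj k
        rw [NatTrans.naturality_apply]
        exact hk
      refine ⟨e.app k ⟨_, hk'⟩, ?_, ?_, ?_⟩
      · have h₁ : (p.app k (e.app k ⟨_, hk'⟩)).1 = b.app k _ :=
          congrArg Subtype.val (congr_app_apply hep ⟨_, hk'⟩)
        rw [h₁]
        exact NatTrans.naturality_apply b φ x
      · have h₁ : T.app k (e.app k ⟨_, hk'⟩) = w.app k _ := congr_app_apply heT ⟨_, hk'⟩
        rw [h₁]
        exact NatTrans.naturality_apply w φ x
      · rw [← hcBS]
        exact NatTrans.naturality_apply cB φ x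
    · rw [← cancel_mono D.ι]
      ext n x
      · exact (hfst n x).symm
      · exact congr_app_apply hw x
      · exact hcBA n x
    · rfl
  · have : k ≫ D.ι ≫ snd _ _ ≫ snd _ _ = J := rfl
    exact mono_of_mono_fac this
  · intro n x hx
    obtain ⟨e, h₁, h₂, h₃⟩ := x.2.2 n (𝟙 n) (by rw [Functor.map_id_apply]; exact hx)
    rw [Functor.map_id_apply] at h₁ h₂ h₃
    exact ⟨e, Subtype.ext (Prod.ext h₁ (Prod.ext h₂ h₃))⟩


/-! ### Horns are deformable -/

/-- The map `Δ[N] ⊗ Δ[1] ⟶ Δ[N]` that is given on vertices by a monotone map. -/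
def simplexProdMap {N : ℕ} (g : Fin (N + 1) × Fin 2 →o Fin (N + 1)) :
    (Δ[N] : SSet.{u}) ⊗ Δ[1] ⟶ Δ[N] where
  app n := ↾fun x => SSet.stdSimplex.objMk (g.comp
    ((SSet.stdSimplex.asOrderHom x.1).prod (SSet.stdSimplex.asOrderHom x.2)))

lemma exists_horn_deformation_of_orderHom {m : ℕ} {l : Fin (m + 2)} {ε δ : Fin 2}
    (g : Fin (m + 2) × Fin 2 →o Fin (m + 2)) (hg : ∀ a t, g (a, t) = a ∨ g (a, t) = l)
    (hε : ∀ a, g (a, ε) = a) (j : Fin (m + 2)) (hj : j ≠ l) (hδ : ∀ a, g (a, δ) ≠ j) :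
    ∃ c : (Δ[m + 1] : SSet.{u}) ⊗ Δ[1] ⟶ Δ[m + 1], incl ε Δ[m + 1] ≫ c = 𝟙 _ ∧
      (∀ n (x : ((Δ[m + 1] : SSet.{u}) ⊗ Δ[1]).obj n),
        x.1 ∈ Λ[m + 1, l].obj n → c.app n x ∈ Λ[m + 1, l].obj n) ∧
      (∀ n (q : (Δ[m + 1] : SSet.{u}).obj n),
        c.app n (q, SSet.stdSimplex.const 1 δ n) ∈ Λ[m + 1, l].obj n) := by
  refine ⟨simplexProdMap g, ?_, ?_, ?_⟩
  · ext n x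
    induction n using Opposite.rec with | _ n
    induction n using SimplexCategory.rec with | _ n
    apply SSet.stdSimplex.ext
    intro i
    exact hε _
  · intro n x hx
    induction n using Opposite.rec with | _ n
    induction n using SimplexCategory.rec with | _ n
    obtain ⟨j, hj, h⟩ := (SSet.mem_horn_iff_notMem_range _ _).1 hx
    refine (SSet.mem_horn_iff_notMem_range _ _).2 ⟨j, hj, ?_⟩
    rintro ⟨i, hi⟩
    rcases hg (x.1 i) (x.2 i) with h' | h'
    · exact h ⟨i, h'.symm.trans hi⟩
    · exact hj (hi.symm.trans h')
  · intro n q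
    induction n using Opposite.rec with | _ n
    induction n using SimplexCategory.rec with | _ n
    refine (SSet.mem_horn_iff_notMem_range _ _).2 ⟨j, hj, ?_⟩
    rintro ⟨i, hi⟩
    exact hδ _ hi

/-- The simplex can be deformed into its `l`-th horn, preserving the horn: for `l ≠ 0` the homotopy
runs from the identity to `max · l`, whose image misses the vertex `0`; for `l = 0` it runs from the
constant map `0` to the identity. -/
lemma exists_horn_deformation {m : ℕ} (l : Fin (m + 2)) :
    ∃ (ε δ : Fin 2) (c : (Δ[m + 1] : SSet.{u}) ⊗ Δ[1] ⟶ Δ[m + 1]), incl ε Δ[m + 1] ≫ c = 𝟙 _ ∧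
      (∀ n (x : ((Δ[m + 1] : SSet.{u}) ⊗ Δ[1]).obj n),
        x.1 ∈ Λ[m + 1, l].obj n → c.app n x ∈ Λ[m + 1, l].obj n) ∧
      (∀ n (q : (Δ[m + 1] : SSet.{u}).obj n),
        c.app n (q, SSet.stdSimplex.const 1 δ n) ∈ Λ[m + 1, l].obj n) := by
  by_cases hl : l = 0
  · subst hl
    refine ⟨1, 0, exists_horn_deformation_of_orderHom
      ⟨fun x => if x.2 = 0 then 0 else x.1, ?_⟩ ?_ ?_ 1 ?_ ?_⟩
    · rintro ⟨a, t⟩ ⟨b, t'⟩ h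
      have h₁ : a ≤ b := h.1
      have h₂ : t ≤ t' := h.2
      dsimp only
      split_ifs with h₃ h₄ h₄
      · rfl
      · exact Fin.zero_le _
      · subst h₄; exact absurd (Fin.le_zero_iff.1 h₂) h₃
      · exact h₁
    · intro a t
      change (if t = 0 then 0 else a) = a ∨ (if t = 0 then 0 else a) = 0
      split_ifs <;> simp
    · intro a
      change (if (1 : Fin 2) = 0 then 0 else a) = a
      simp
    · simp
    · intro a
      change (if (0 : Fin 2) = 0 then 0 else a) ≠ 1
      simp
  · refine ⟨0, 1, exists_horn_deformation_of_orderHom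
      ⟨fun x => if x.2 = 0 then x.1 else max x.1 l, ?_⟩ ?_ ?_ 0 (Ne.symm hl) ?_⟩
    · rintro ⟨a, t⟩ ⟨b, t'⟩ h
      have h₁ : a ≤ b := h.1
      have h₂ : t ≤ t' := h.2
      dsimp only
      split_ifs with h₃ h₄ h₄
      · exact h₁
      · exact h₁.trans (le_max_left _ _)
      · subst h₄; exact absurd (Fin.le_zero_iff.1 h₂) h₃
      · exact max_le_max h₁ le_rfl
    · intro a t
      change (if t = 0 then a else max a l) = a ∨ (if t = 0 then a else max a l) = l
      split_ifs
      · exact Or.inl rfl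
      · exact max_choice a l
    · intro a
      change (if (0 : Fin 2) = 0 then a else max a l) = a
      simp
    · intro a h
      have h' : max a l = 0 := h
      exact hl (Fin.le_zero_iff.1 (h' ▸ le_max_right a l))

/-! ### Fibrations that are subcomplexes of a product -/

section Subfibrations

variable {C : SSet.{u}}

lemma isPullback_fromPreimage {A B : SSet.{u}} (D : (A ⊗ C).Subcomplex) (f : B ⟶ A) :
    IsPullback (D.fromPreimage (f ▷ C)) ((D.preimage (f ▷ C)).ι ≫ fst _ _) (D.ι ≫ fst _ _) f := by
  refine ⟨⟨rfl⟩, ⟨Limits.PullbackCone.IsLimit.mk _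
    (fun s => SSet.Subcomplex.lift (lift s.snd (s.fst ≫ D.ι ≫ snd _ _)) ?_) ?_ ?_ ?_⟩⟩
  · rintro n _ ⟨x, rfl⟩
    have h : (s.fst.app n x).1.1 = f.app n (s.snd.app n x) := congr_app_apply s.condition x
    change (f.app n (s.snd.app n x), (s.fst.app n x).1.2) ∈ D.obj n
    rw [← h]
    exact (s.fst.app n x).2
  · intro s
    rw [← cancel_mono D.ι]
    ext n x
    · exact (congr_app_apply s.condition x).symm
    · rfl
  · intro s
    rfl
  · intro s m h₁ h₂
    rw [← cancel_mono (D.preimage (f ▷ C)).ι]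
    ext n x
    · exact congr_app_apply h₂ x
    · exact congr_app_apply (h₁ =≫ (D.ι ≫ snd _ _)) x

lemma fibrations.of_isPullback {X X' Y Y' : SSet.{u}} {k : X ⟶ X'} {p : X ⟶ Y} {q : X' ⟶ Y'}
    {j : Y ⟶ Y'} (sq : IsPullback k p q j) (hq : fibrations q) : fibrations p := by
  rw [fibrations_eq_rlp] at *
  exact MorphismProperty.of_isPullback sq hq

/-- Being a Kan fibration can be checked after pullback to the simplices of the base. -/
lemma fibrations_of_preimage {Y : SSet.{u}} (D : (Y ⊗ C).Subcomplex)
    (h : ∀ (n : ℕ) (σ : Δ[n] ⟶ Y), fibrations ((D.preimage (σ ▷ C)).ι ≫ fst _ _)) :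
    fibrations (D.ι ≫ fst _ _) := by
  intro m l
  constructor
  intro f b sq
  have hD := isPullback_fromPreimage D b
  obtain ⟨g, hg₁, hg₂⟩ := (h _ b).exists_lift (SSet.anodyneExtensions.horn_ι l)
    (f := hD.lift f (SSet.horn (m + 1) l).ι sq.w) (g := 𝟙 _) (by simp)
  refine ⟨⟨g ≫ D.fromPreimage (b ▷ C), ?_, ?_⟩⟩
  · rw [reassoc_of% hg₁, hD.lift_fst]
  · rw [Category.assoc, hD.w, ← Category.assoc, hg₂, Category.id_comp]

lemma fibrations_range_of_mono {X Y : SSet.{u}} {p : X ⟶ Y} (hp : fibrations p) (a : X ⟶ C)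
    [Mono (lift p a)] : fibrations ((SSet.Subcomplex.range (lift p a)).ι ≫ fst _ _) := by
  have h : SSet.Subcomplex.toRange (lift p a) ≫
    (SSet.Subcomplex.range (lift p a)).ι ≫ fst _ _ = p := rfl
  rw [← h] at hp
  rw [fibrations_eq_rlp] at *
  exact (MorphismProperty.cancel_left_of_respectsIso _ _ _).1 hp

end Subfibrations

/-! ### A universe of fibrations -/

section Universe

open Cardinal

variable {C : SSet.{u}} {κ : Cardinal.{u}}

lemma mk_preimage_le (hκ : ℵ₀ ≤ κ) {A B : SSet.{u}} (D : (A ⊗ C).Subcomplex) (f : B ⟶ A)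
    {n : SimplexCategoryᵒᵖ} (hB : #(B.obj n) ≤ κ) (hD : #(D.obj n) ≤ κ) :
    #((D.preimage (f ▷ C)).obj n) ≤ κ := by
  have : Function.Injective (fun x : (D.preimage (f ▷ C)).obj n =>
      ((x.1.1, (D.fromPreimage (f ▷ C)).app n x) : B.obj n × D.obj n)) := by
    rintro ⟨⟨b, c⟩, h⟩ ⟨⟨b', c'⟩, h'⟩ hx
    have h₁ : b = b' := congrArg Prod.fst hx
    have h₂ : c = c' := congrArg (fun y : B.obj n × D.obj n => y.2.1.2) hx
    subst h₁ h₂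
    rfl
  refine (mk_le_of_injective this).trans ?_
  rw [mk_prod, lift_id, lift_id]
  exact (mul_le_mul' hB hD).trans (mul_eq_self hκ).le

lemma mk_range_obj_le {X Y : SSet.{u}} (f : X ⟶ Y) (n : SimplexCategoryᵒᵖ) :
    #((SSet.Subcomplex.range f).obj n) ≤ #(X.obj n) :=
  mk_le_of_surjective (f := (SSet.Subcomplex.toRange f).app n) (by
    rintro ⟨_, x, rfl⟩
    exact ⟨x, rfl⟩)

lemma mk_stdSimplex_le (hκ : ℵ₀ ≤ κ) (N : SimplexCategory) (n : SimplexCategoryᵒᵖ) :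
    #((SSet.stdSimplex.{u}.obj N).obj n) ≤ κ :=
  (mk_le_aleph0_iff.2 (Finite.to_countable)).trans hκ

variable (C κ) in
/-- The simplicial set whose `n`-simplices are the subcomplexes of `Δ[n] ⊗ C` that are Kan fibrations
over `Δ[n]` and have at most `κ` simplices in each degree. Taking subcomplexes of a fixed product
makes pullback strictly functorial. -/
def fibrationUniverse (hκ : ℵ₀ ≤ κ) : SSet.{u} where
  obj n := {D : (SSet.stdSimplex.{u}.obj n.unop ⊗ C).Subcomplex //
    fibrations (D.ι ≫ fst _ _) ∧ ∀ k, #(D.obj k) ≤ κ}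
  map φ := ↾fun D => ⟨D.1.preimage (SSet.stdSimplex.map φ.unop ▷ C),
    D.2.1.of_isPullback (isPullback_fromPreimage _ _),
    fun k => mk_preimage_le hκ _ _ (mk_stdSimplex_le hκ _ _) (D.2.2 k)⟩
  map_id n := by
    refine ConcreteCategory.hom_ext _ _ fun D => Subtype.ext ?_
    change D.1.preimage (SSet.stdSimplex.map (𝟙 n.unop) ▷ C) = D.1
    have h : SSet.stdSimplex.{u}.map (𝟙 n.unop) = 𝟙 _ := CategoryTheory.Functor.map_id _ _
    rw [h, id_whiskerRight, SSet.Subcomplex.preimage_id]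
  map_comp φ ψ := by
    refine ConcreteCategory.hom_ext _ _ fun D => Subtype.ext ?_
    change D.1.preimage (SSet.stdSimplex.map (ψ.unop ≫ φ.unop) ▷ C) =
      (D.1.preimage (SSet.stdSimplex.map φ.unop ▷ C)).preimage (SSet.stdSimplex.map ψ.unop ▷ C)
    have h : SSet.stdSimplex.{u}.map (ψ.unop ≫ φ.unop) =
      SSet.stdSimplex.map ψ.unop ≫ SSet.stdSimplex.map φ.unop :=
        CategoryTheory.Functor.map_comp _ _ _
    rw [h, comp_whiskerRight, SSet.Subcomplex.preimage_comp]

variable {hκ : ℵ₀ ≤ κ}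

/-- The classifying map of a Kan fibration over `Y` inside `Y ⊗ C`: it sends a simplex of `Y` to the
pullback of the fibration to it. -/
def classify {Y : SSet.{u}} (D : (Y ⊗ C).Subcomplex) (hD : fibrations (D.ι ≫ fst _ _))
    (hD' : ∀ k, #(D.obj k) ≤ κ) : Y ⟶ fibrationUniverse C κ hκ where
  app n := ↾fun y => ⟨D.preimage ((SSet.yonedaEquiv (n := n.unop)).symm y ▷ C),
    hD.of_isPullback (isPullback_fromPreimage _ _),
    fun k => mk_preimage_le hκ _ _ (mk_stdSimplex_le hκ _ _) (hD' k)⟩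
  naturality n m φ := by
    ext y
    apply Subtype.ext
    change D.preimage ((SSet.yonedaEquiv (n := m.unop)).symm (Y.map φ y) ▷ C) =
      (D.preimage ((SSet.yonedaEquiv (n := n.unop)).symm y ▷ C)).preimage
        (SSet.stdSimplex.map φ.unop ▷ C)
    rw [← SSet.Subcomplex.preimage_comp, ← comp_whiskerRight]
    congr 2
    exact (SSet.yonedaEquiv_symm_naturality_left φ.unop y).symm

/-- The Kan fibration over `Y` inside `Y ⊗ C` that is classified by `χ`. -/
def classified {Y : SSet.{u}} (χ : Y ⟶ fibrationUniverse C κ hκ) : (Y ⊗ C).Subcomplex where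
  obj n := {x | ((SSet.stdSimplex.objEquiv.symm (𝟙 n.unop), x.2) :
    (SSet.stdSimplex.obj n.unop ⊗ C).obj n) ∈ (χ.app n x.1).1.obj n}
  map := by
    rintro n m φ ⟨y, c⟩ h
    have h₁ := (χ.app n y).1.map φ h
    change ((SSet.stdSimplex.objEquiv.symm (𝟙 m.unop), C.map φ c) :
      (SSet.stdSimplex.obj m.unop ⊗ C).obj m) ∈ (χ.app m (Y.map φ y)).1.obj m
    rw [NatTrans.naturality_apply]
    exact h₁

lemma classified_preimage_yonedaEquiv {Y : SSet.{u}} (χ : Y ⟶ fibrationUniverse C κ hκ)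
    {n : SimplexCategoryᵒᵖ} (y : Y.obj n) :
    (classified χ).preimage ((SSet.yonedaEquiv (n := n.unop)).symm y ▷ C) = (χ.app n y).1 := by
  ext m ⟨φ, c⟩
  obtain ⟨φ, rfl⟩ := SSet.stdSimplex.objEquiv.symm.surjective φ
  change ((SSet.stdSimplex.objEquiv.symm (𝟙 m.unop), c) :
      (SSet.stdSimplex.obj m.unop ⊗ C).obj m) ∈ (χ.app m (Y.map φ.op y)).1.obj m ↔ _
  rw [NatTrans.naturality_apply]
  change ((SSet.stdSimplex.objEquiv.symm (𝟙 m.unop ≫ φ), c) :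
      (SSet.stdSimplex.obj n.unop ⊗ C).obj m) ∈ (χ.app n y).1.obj m ↔ _
  rw [Category.id_comp]
  exact Iff.rfl

lemma classified_comp {Y Y' : SSet.{u}} (f : Y' ⟶ Y) (χ : Y ⟶ fibrationUniverse C κ hκ) :
    classified (f ≫ χ) = (classified χ).preimage (f ▷ C) := rfl

lemma classified_classify {Y : SSet.{u}} (D : (Y ⊗ C).Subcomplex)
    (hD : fibrations (D.ι ≫ fst _ _)) (hD' : ∀ k, #(D.obj k) ≤ κ) :
    classified (classify (hκ := hκ) D hD hD') = D := by
  ext n ⟨y, c⟩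
  change (Y.map (𝟙 n) y, c) ∈ D.obj n ↔ _
  rw [Functor.map_id_apply]
  exact Iff.rfl

lemma fibrations_classified {Y : SSet.{u}} (χ : Y ⟶ fibrationUniverse C κ hκ) :
    fibrations ((classified χ).ι ≫ fst _ _) := by
  apply fibrations_of_preimage
  intro n σ
  obtain ⟨y, rfl⟩ := SSet.yonedaEquiv.symm.surjective σ
  have := (χ.app (op ⦋n⦌) y).2.1
  rw [← classified_preimage_yonedaEquiv] at this
  exact this

lemma mk_classified_le {Y : SSet.{u}} (χ : Y ⟶ fibrationUniverse C κ hκ)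
    {n : SimplexCategoryᵒᵖ} (hY : #(Y.obj n) ≤ κ) : #((classified χ).obj n) ≤ κ := by
  let g : (classified χ).obj n → Σ y : Y.obj n, (χ.app n y).1.obj n := fun x => ⟨x.1.1, ⟨_, x.2⟩⟩
  have hg : Function.Injective g := by
    rintro ⟨⟨y, c⟩, h⟩ ⟨⟨y', c'⟩, h'⟩ hx
    obtain rfl : y = y' := congrArg Sigma.fst hx
    have h₂ := congrArg (fun z => z.1.2) (eq_of_heq (Sigma.mk.inj hx).2)
    obtain rfl : c = c' := h₂
    rfl
  refine (mk_le_of_injective hg).trans ?_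
  rw [mk_sigma]
  refine (sum_le_sum _ (fun _ => κ) (fun y => (χ.app n y).2.2 n)).trans ?_
  rw [sum_const']
  exact (mul_le_mul' hY le_rfl).trans (mul_eq_self hκ).le

lemma hom_fibrationUniverse_ext {Y : SSet.{u}} {χ χ' : Y ⟶ fibrationUniverse C κ hκ}
    (h : classified χ = classified χ') : χ = χ' := by
  ext n y
  apply Subtype.ext
  refine (classified_preimage_yonedaEquiv χ y).symm.trans (Eq.trans ?_
    (classified_preimage_yonedaEquiv χ' y))
  rw [h]

end Universe


/-! ### The universe is a Kan complex -/

section FibrationUniverseIsKan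

open Cardinal

lemma exists_injective_extension {α β T : Type u} {κ : Cardinal.{u}} (hκ : ℵ₀ ≤ κ) (hT : κ < #T)
    (k : α → β) (hk : Function.Injective k) (hβ : #β ≤ κ) (f : α → T) :
    ∃ μ : β → T, (∀ a, μ (k a) = f a) ∧
      ∀ x x', x ∉ Set.range k → μ x = μ x' → x = x' := by
  classical
  have : Infinite T := infinite_iff.2 (hκ.trans hT.le)
  have hα : #(Set.range f) < #T :=
    (mk_range_le.trans (mk_le_of_injective hk)).trans_lt (hβ.trans_lt hT)
  have hc : #((Set.range f)ᶜ : Set T) = #T := mk_compl_of_infinite _ hα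
  obtain ⟨g⟩ : #β ≤ #((Set.range f)ᶜ : Set T) := by
    rw [hc]
    exact hβ.trans hT.le
  refine ⟨fun x => if h : ∃ a, k a = x then f h.choose else (g x).1, fun a => ?_, ?_⟩
  · have h : ∃ b, k b = k a := ⟨a, rfl⟩
    exact (dif_pos h).trans (by rw [hk h.choose_spec])
  · intro x x' hx hxx
    replace hxx := (dif_neg (show ¬ ∃ a, k a = x from hx)).symm.trans hxx
    dsimp only at hxx
    split_ifs at hxx with h
    · exact absurd ⟨_, hxx.symm⟩ (g x).2
    · exact g.injective (Subtype.ext hxx)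

lemma mk_cofree_le {κ : Cardinal.{u}} (hκ : ℵ₀ ≤ κ) (hκ' : κ ^ ℵ₀ = κ) {T : Type u}
    (hT : #T ≤ κ) (n : SimplexCategoryᵒᵖ) : #((cofree T).obj n) ≤ κ := by
  change #((Σ k : ℕ, ⦋k⦌ ⟶ n.unop) → T) ≤ κ
  have hc : #(Σ k : ℕ, ⦋k⦌ ⟶ n.unop) ≤ ℵ₀ := mk_le_aleph0
  rw [mk_arrow, lift_uzero]
  refine (power_le_power_right hT).trans ((power_le_power_left ?_ (lift_le.2 hc)).trans ?_)
  · exact (aleph0_pos.trans_le hκ).ne'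
  · rw [lift_aleph0, hκ']

variable {κ : Cardinal.{u}}

/-- The form of `exists_fibration_extension` for subcomplexes of products with `cofree T`. The
extension given there is embedded into `Q ⊗ cofree T` compatibly with the given embedding over `P`:
simplices not over `P` get labels in `T` that are new and distinct, which is possible as `κ < #T`.
The hypothesis `κ ^ ℵ₀ = κ` bounds the size of the extension. -/
lemma exists_subcomplex_extension (hκ : ℵ₀ ≤ κ) (hκ' : κ ^ ℵ₀ = κ) {T : Type u} (hT : κ < #T)
    {Q : SSet.{u}} (hQ : ∀ n, #(Q.obj n) ≤ κ) (P : Q.Subcomplex) {c : Q ⊗ Δ[1] ⟶ Q}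
    {ε δ : Fin 2} (hcε : incl ε Q ≫ c = 𝟙 Q)
    (hcP : ∀ n (x : (Q ⊗ Δ[1]).obj n), x.1 ∈ P.obj n → c.app n x ∈ P.obj n)
    (hcδ : ∀ n (q : Q.obj n), c.app n (q, SSet.stdSimplex.const 1 δ n) ∈ P.obj n)
    (D₀ : ((P : SSet) ⊗ cofree T).Subcomplex) (hD₀ : fibrations (D₀.ι ≫ fst _ _))
    (hD₀κ : ∀ n, #(D₀.obj n) ≤ κ) :
    ∃ D : (Q ⊗ cofree T).Subcomplex, fibrations (D.ι ≫ fst _ _) ∧ (∀ n, #(D.obj n) ≤ κ) ∧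
      D.preimage (P.ι ▷ cofree T) = D₀ := by
  let T' : Type u := Option (Σ k : ℕ, (D₀ : SSet) _⦋k⦌)
  let J : (D₀ : SSet) ⟶ cofree T' := toCofree fun k x => some ⟨k, x⟩
  have : Mono J := mono_toCofree _ fun k x y h =>
    eq_of_heq (Sigma.mk.inj (Option.some.inj h)).2
  have hT' : #T' ≤ κ := by
    rw [mk_option, mk_sigma]
    refine add_le_of_le hκ ?_ (one_le_aleph0.trans hκ)
    refine (sum_le_sum _ (fun _ => κ) fun k => hD₀κ _).trans ?_
    rw [sum_const, mk_nat, lift_aleph0, lift_uzero]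
    exact (mul_le_mul' hκ le_rfl).trans (mul_eq_self hκ).le
  obtain ⟨E, k, hE, hk, _, hkP⟩ := exists_fibration_extension P hcε hcP hcδ hD₀ J
    (fun i _ f => cofree_extend i f)
  have hEκ : ∀ n, #(E.obj n) ≤ κ := by
    intro n
    refine (mk_le_of_injective Subtype.val_injective).trans ?_
    change #(Q.obj n × ((D₀ : SSet).obj n × (cofree T').obj n)) ≤ κ
    rw [mk_prod, mk_prod]
    simp only [lift_id]
    refine (mul_le_mul' (hQ n) ((mul_le_mul' (hD₀κ n) (mk_cofree_le hκ hκ' hT' n)).trans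
      (mul_eq_self hκ).le)).trans (mul_eq_self hκ).le
  choose μ hμ hμ' using fun j : ℕ => exists_injective_extension hκ hT (k.app (op ⦋j⦌))
    (injective_of_mono k _) (hEκ _) (fun e => cofreeEval e.1.2)
  let a : (E : SSet) ⟶ cofree T := toCofree μ
  have ha : k ≫ a = D₀.ι ≫ snd _ _ := cofree_hom_ext fun j e =>
    (cofreeEval_comp_toCofree k μ e).trans (hμ j e)
  have hP : ∀ n (e : D₀.obj n), (k.app n e).1.1 = e.1.1.1 := fun n e => congr_app_apply hk e
  have hak : ∀ n (e : D₀.obj n), a.app n (k.app n e) = e.1.2 := fun n e => congr_app_apply ha e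
  have hmono : Mono (lift (E.ι ≫ fst _ _) a) := by
    apply mono_of_injective
    intro n x y hxy
    have h₁ : x.1.1 = y.1.1 := congrArg ((fst Q (cofree T)).app n) hxy
    have h₂ : a.app n x = a.app n y := congrArg ((snd Q (cofree T)).app n) hxy
    induction n using Opposite.rec with | _ n
    induction n using SimplexCategory.rec with | _ n
    by_cases hx : x.1.1 ∈ P.obj _
    · obtain ⟨e, rfl⟩ := hkP _ x hx
      obtain ⟨e', rfl⟩ := hkP _ y (h₁ ▸ hx)
      congr 1
      apply Subtype.ext
      apply Prod.ext
      · apply Subtype.ext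
        exact (hP _ e).symm.trans (h₁.trans (hP _ e'))
      · exact (hak _ e).symm.trans (h₂.trans (hak _ e'))
    · refine hμ' n x y ?_ ?_
      · rintro ⟨e, rfl⟩
        exact hx ((congrArg (· ∈ P.obj _) (hP _ e)).mpr e.1.1.2)
      · rw [← cofreeEval_toCofree μ x, ← cofreeEval_toCofree μ y]
        exact congrArg cofreeEval h₂
  refine ⟨_, fibrations_range_of_mono hE a, fun n => ?_, ?_⟩
  · exact (mk_range_obj_le _ n).trans (hEκ n)
  · ext n ⟨q, t⟩
    constructor
    · rintro ⟨x, hx⟩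
      have h₁ : x.1.1 = q.1 := congrArg Prod.fst hx
      have h₂ : a.app n x = t := congrArg Prod.snd hx
      obtain ⟨e, rfl⟩ := hkP n x (h₁ ▸ q.2)
      have he : e.1 = (q, t) := Prod.ext (Subtype.ext ((hP n e).symm.trans h₁))
        ((hak n e).symm.trans h₂)
      rw [← he]
      exact e.2
    · intro h
      exact ⟨k.app n ⟨(q, t), h⟩, Prod.ext (hP n ⟨(q, t), h⟩) (hak n ⟨(q, t), h⟩)⟩

/-- A horn in the universe is a Kan fibration over the horn, and a filler is an extension of it to the
simplex. -/
lemma isKanComplex_fibrationUniverse (hκ : ℵ₀ ≤ κ) (hκ' : κ ^ ℵ₀ = κ) {T : Type u}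
    (hT : κ < #T) : IsKanComplex (fibrationUniverse (cofree T) κ hκ) := by
  intro m l
  constructor
  intro χ b sq
  obtain ⟨ε, δ, c, hcε, hcP, hcδ⟩ := exists_horn_deformation.{u} l
  have hQ : ∀ n, #((Δ[m + 1] : SSet.{u}).obj n) ≤ κ := fun n => mk_stdSimplex_le hκ _ n
  obtain ⟨D, hD, hDκ, hDP⟩ := exists_subcomplex_extension hκ hκ' hT hQ _ hcε hcP hcδ
    (classified χ) (fibrations_classified χ) (fun n => mk_classified_le χ
      ((mk_le_of_injective Subtype.val_injective).trans (hQ n)))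
  refine ⟨⟨classify D hD hDκ, hom_fibrationUniverse_ext ?_, Limits.terminal.hom_ext _ _⟩⟩
  rw [classified_comp, classified_classify, hDP]

/-! ### Monomorphisms are cofibrations -/

lemma exists_kan_replacement (Y : SSet.{u}) :
    ∃ (Y' : SSet.{u}) (j : Y ⟶ Y'), SSet.anodyneExtensions j ∧ IsKanComplex Y' := by
  let F := MorphismProperty.factorizationData SSet.modelCategoryQuillen.J.{u}.rlp.llp
    SSet.modelCategoryQuillen.J.{u}.rlp (Limits.terminal.from Y)
  refine ⟨F.Z, F.i, F.hi, ?_⟩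
  have := F.hp
  rw [← fibrations_iff] at this
  rwa [Limits.terminal.hom_ext F.p (Limits.terminal.from _)] at this

/-- Every Kan fibration is the pullback of a Kan fibration over a Kan complex along an anodyne
map. -/
lemma exists_isPullback_of_fibration {X Y : SSet.{u}} {p : X ⟶ Y} (hp : fibrations p) :
    ∃ (X' Y' : SSet.{u}) (k : X ⟶ X') (q : X' ⟶ Y') (j : Y ⟶ Y'), IsPullback k p q j ∧
      fibrations q ∧ SSet.anodyneExtensions j ∧ IsKanComplex Y' := by
  -- A power of two with infinite exponent satisfies `κ ^ ℵ₀ = κ`.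
  let κ : Cardinal.{u} := 2 ^ max ℵ₀ #(Σ k : ℕ, X _⦋k⦌)
  have hκ : ℵ₀ ≤ κ := (le_max_left _ _).trans (cantor _).le
  have hκ' : κ ^ ℵ₀ = κ := by
    rw [← power_mul, mul_aleph0_eq (le_max_left _ _)]
  have hX : ∀ n, #(X.obj n) ≤ κ := by
    intro n
    induction n using Opposite.rec with | _ n
    induction n using SimplexCategory.rec with | _ n
    refine le_trans ?_ ((le_max_right _ _).trans (cantor _).le)
    exact mk_le_of_injective (f := fun x => (⟨n, x⟩ : Σ k : ℕ, X _⦋k⦌))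
      (fun x y h => by simpa using h)
  let T : Type u := Set κ.out
  have hT : κ < #T := by
    rw [mk_set, mk_out]
    exact cantor κ
  have hμ : ∀ k : ℕ, Nonempty (X _⦋k⦌ ↪ T) := fun k => (hX _).trans hT.le
  let a : X ⟶ cofree T := toCofree fun k => (hμ k).some
  have : Mono a := mono_toCofree _ fun k => (hμ k).some.injective
  have hla : Mono (lift p a) := mono_of_mono_fac (lift_snd p a)
  obtain ⟨Y', j, hj, hY'⟩ := exists_kan_replacement Y
  let D := SSet.Subcomplex.range (lift p a)
  have hDκ : ∀ n, #(D.obj n) ≤ κ := fun n =>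
    (mk_range_obj_le _ n).trans (hX n)
  obtain ⟨χ, hχ, -⟩ := (isKanComplex_fibrationUniverse hκ hκ' hT).exists_lift hj
    (f := classify D (fibrations_range_of_mono hp a) hDκ) (g := Limits.terminal.from Y')
    (Limits.terminal.hom_ext _ _)
  have hD : (classified χ).preimage (j ▷ cofree T) = D := by
    rw [← classified_comp, hχ, classified_classify]
  let e : X ≅ (classified χ).preimage (j ▷ cofree T) :=
    asIso (SSet.Subcomplex.toRange (lift p a)) ≪≫ SSet.Subcomplex.eqToIso hD.symm
  have sq : IsPullback e.hom p (((classified χ).preimage (j ▷ cofree T)).ι ≫ fst _ _) (𝟙 Y) :=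
    .of_horiz_isIso ⟨(Category.comp_id p).symm ▸ rfl⟩
  exact ⟨_, Y', _, _, 𝟙 Y ≫ j, sq.paste_horiz (isPullback_fromPreimage (classified χ) j),
    fibrations_classified χ, by rwa [Category.id_comp], hY'⟩

end FibrationUniverseIsKan

lemma cofibrations_of_mono {A B : SSet.{u}} (i : A ⟶ B) [Mono i] : cofibrations i := by
  rintro X Y p ⟨hp, hw⟩
  obtain ⟨X', Y', k, q, j, sq, hq, hj, hY'⟩ := exists_isPullback_of_fibration hp
  constructor
  intro f g w
  obtain ⟨l, h₁, h₂⟩ := exists_lift_of_isPullback sq hp hw hq hj hY' i f g w.w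
  exact ⟨⟨l, h₁, h₂⟩⟩

end SimplicialModel

theorem proposition3p1 :
    (∀ {A B : SSet.{u}} (i : A ⟶ B),
      List.TFAE
        [SimplicialModel.cofibrations i,
          Mono i,
          ∀ n : SimplexCategoryᵒᵖ, Function.Injective (i.app n)]) ∧
    (∀ X : SSet.{u}, SimplicialModel.IsCofibrant X) := by
  refine ⟨fun {A B} i => ?_, fun X => ?_⟩
  · tfae_have 1 → 2 := SimplicialModel.mono_of_cofibrations i
    tfae_have 2 → 1 := fun _ => SimplicialModel.cofibrations_of_mono i
    tfae_have 2 → 3 := fun _ => SimplicialModel.injective_of_mono i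
    tfae_have 3 → 2 := SimplicialModel.mono_of_injective i
    tfae_finish
  · have : Mono (Limits.initial.to X) := by
      apply SimplicialModel.mono_of_injective
      intro n x
      exact ((Limits.initial.to ((⊥ : X.Subcomplex) : SSet)).app n x).2.elim
    exact SimplicialModel.cofibrations_of_mono _
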